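/- **Setting.** Let $\Sigma$ consist of two binary predicate letters $R,E$ and countably many further predicate letters of each arity $\ge 1$. A vocabulary $\Theta$ is a subset of $\Sigma$ containing $R$ and $E$. A formula is a formula of classical first-order logic with identity over $\Sigma$ (no function symbols or constants); $\Sigma_\varphi$ denotes $\{R,E\}$ together with the predicate letters occurring in $\varphi$, and $\varphi$ is a $\Theta$-formula if its predicate letters are in $\Theta$. We write $\varphi(x,\bar w_n)$, $n\ge 0$, if the free variables of $\varphi$ are among the distinct variables $x,w_1,\dots,w_n$; for a $\Theta$-model $M$ (with non-empty domain $D(M)$) and $a,b_1,\dots,b_n\in D(M)$, $M,a,\bar b_n\models\varphi$ means that $\varphi$ is true in $M$ under $x\mapsto a$, $w_i\mapsto b_i$. An intuitionistic formula is a formula of intuitionistic predicate logic without identity, built from predicate letters of arities $\ge 0$ with $\bot,\wedge,\vee,\to,\exists,\forall$. Fix, for each $k\ge 0$, a surjection $P\mapsto P'$ from the $k$-ary intuitionistic predicate letters onto the $(k+1)$-ary letters of $\Sigma\setminus\{R,E\}$. The standard $x$-translation $ST(i,x)$ is given by $ST(P(\bar u_k),x)=P'(x,\bar u_k)$; $ST(\bot,x)=(x\ne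 x)$; $ST(i\wedge j,x)=ST(i,x)\wedge ST(j,x)$; $ST(i\vee j,x)=ST(i,x)\vee ST(j,x)$; $ST(i\to j,x)=\forall y(R(x,y)\to(ST(i,y)\to ST(j,y)))$; $ST(\exists w\, i,x)=\exists w(E(x,w)\wedge ST(i,x))$; $ST(\forall w\, i,x)=\forall y\forall w((R(x,y)\wedge E(y,w))\to ST(i,y))$, with $y$, $w$ fresh. **Asimulations.** Let $M,N$ be $\Theta$-models with (without loss of generality) disjoint domains, $a,\bar b_n$ in $M$ and $c,\bar d_n$ in $N$. An $\langle(M,a,\bar b_n),(N,c,\bar d_n)\rangle$-asimulation is a relation $A\subseteq\bigcup_{l\ge 0}\big((D(M)^{1+l}\times D(N)^{1+l})\cup(D(N)^{1+l}\times D(M)^{1+l})\big)$ such that $(a;\bar b_n)\,A\,(c;\bar d_n)$ and, whenever $\{\alpha,\beta\}=\{M,N\}$, $(a';\bar b'_l)$ is from $\alpha$, $(c';\bar d'_l)$ is from $\beta$ and $(a';\bar b'_l)\,A\,(c';\bar d'_l)$: 1. for every $(k+1)$-ary $P\in\Theta\setminus\{R,E\}$ and all indices $t_1,\dots,t_k\in\{1,\dots,l\}$,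 if $P^\alpha(a',b'_{t_1},\dots,b'_{t_k})$ then $P^\beta(c',d'_{t_1},\dots,d'_{t_k})$; 2. if $c'R^\beta c''$, then there is $a''$ with $a'R^\alpha a''$, $(c'';\bar d'_l)\,A\,(a'';\bar b'_l)$ and $(a'';\bar b'_l)\,A\,(c'';\bar d'_l)$; 3. if $E^\alpha(a',b'')$, then there is $d''$ with $E^\beta(c',d'')$ and $(a';\bar b'_l,b'')\,A\,(c';\bar d'_l,d'')$; 4. if $c'R^\beta c''$ and $E^\beta(c'',d'')$, then there are $a'',b''$ with $a'R^\alpha a''$, $E^\alpha(a'',b'')$ and $(a'';\bar b'_l,b'')\,A\,(c'';\bar d'_l,d'')$. **Classes of models.** Let $K$ be a class of models (of possibly different vocabularies), and let $K(\Theta)$ be the class of $\Theta$-models in $K$. $K(\Theta)$ is first-order axiomatizable if there is a set $Ax$ of $\Theta$-sentences such that every $\Theta$-model $M$ satisfies $M\in K\iff M\models Ax$. A set of formulas $\Gamma$ is $K$-satisfiable if some model in $K$ whose vocabulary contains the letters of $\Gamma$ satisfies $\Gamma$ under some assignment; $\Gamma\models_K\varphi$ means that $\Gamma\cup\{\neg\varphi\}$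 is not $K$-satisfiable; $\varphi,\psi$ are $K$-equivalent if $\varphi\models_K\psi$ and $\psi\models_K\varphi$. A formula $\varphi(x,\bar w_n)$ is $K$-invariant with respect to asimulations if for every vocabulary $\Theta\supseteq\Sigma_\varphi$, all $\Theta$-models $M,N\in K$ and all $a,\bar b_n$ in $M$ and $c,\bar d_n$ in $N$ such that an $\langle(M,a,\bar b_n),(N,c,\bar d_n)\rangle$-asimulation exists, $M,a,\bar b_n\models\varphi$ implies $N,c,\bar d_n\models\varphi$. **Theorem.** Let $K$ be a class of first-order models that is closed under reducts to finite vocabularies and such that $K(\Theta)$ is first-order axiomatizable for every finite vocabulary $\Theta$. Then, for every $n\ge 0$, a formula $\varphi(x,\bar w_n)$ is $K$-invariant with respect to asimulations if and only if there is an intuitionistic formula $i(\bar w_n)$ such that $ST(i,x)$ is a $\Sigma_\varphi$-formula and $\varphi$ is $K$-equivalent to $ST(i,x)$. Moreover, these hypotheses on $K$ (and hence the equivalence) hold for the class of all intuitionistic models and for the class of all intuitionistic models with constant domains. Here a model is *intuitionistic* if, calling $y$ a world when $\exists z\,E(y,z)$ and calling $z$ an object when $\exists y\,E(y,z)$: every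 element is either a world or an object and not both; $R$ holds between worlds only and is reflexive on worlds and transitive; if $P(y,\bar w_k)$ and $R(y,z)$ then $P(z,\bar w_k)$, for $P=E$ and for every other letter $P\ne R$ of the vocabulary; and $P(y,\bar w_k)$ implies $E(y,w_1),\dots,E(y,w_k)$. It has *constant domains* if moreover $E(y,z)$ for every world $y$ and every object $z$. -/

import Mathlib

open FirstOrder

universe u v

namespace PredAsim

/-- The predicate letters of `Σ`, indexed by their arity: the two binary letters `R`, `E`, and
countably many further letters `P k m` of each arity `k + 1 ≥ 1`. -/
inductive Rel : ℕ → Type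
  | R : Rel 2
  | E : Rel 2
  | P (k m : ℕ) : Rel (k + 1)

/-- A predicate letter together with its arity. -/
abbrev Letter : Type := Σ n, Rel n

/-- The classical first-order language (with identity) of `Σ`. -/
def sig : Language where
  Functions := fun _ => Empty
  Relations := Rel

/-- A vocabulary `Θ`: a set of predicate letters that contains `R` and `E`. -/
structure Vocabulary where
  letters : Set Letter
  R_mem : (⟨2, Rel.R⟩ : Letter) ∈ letters
  E_mem : (⟨2, Rel.E⟩ : Letter) ∈ letters

/-- The predicate letters that occur in a formula. -/
def letters {α : Type} : ∀ {m : ℕ}, sig.BoundedFormula α m → Set Letter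
  | _, .falsum => ∅
  | _, .equal _ _ => ∅
  | _, .rel (l := k) r _ => {(⟨k, r⟩ : Letter)}
  | _, .imp φ ψ => letters φ ∪ letters ψ
  | _, .all φ => letters φ

/-- `Σ_φ`: the letters `R`, `E` and the predicate letters that occur in `φ`. -/
def vocOf {α : Type} (φ : sig.Formula α) : Vocabulary where
  letters := {⟨2, Rel.R⟩, ⟨2, Rel.E⟩} ∪ letters φ
  R_mem := Or.inl (Or.inl rfl)
  E_mem := Or.inl (Or.inr rfl)

/-- `φ` is a `Θ`-formula. -/
def IsFormulaOver (Θ : Vocabulary) {α : Type} (φ : sig.Formula α) : Prop :=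
  letters φ ⊆ Θ.letters

/-- A first-order model: a non-empty domain, a vocabulary `Θ`, and an interpretation of the letters
of `Θ`. Letters outside of `Θ` formally get the empty interpretation, so a model with vocabulary `Θ`
is the same thing as a `Θ`-model; formulas are only ever evaluated in models whose vocabulary
contains all of their letters. -/
structure Model where
  Dom : Type u
  nonempty : Nonempty Dom
  voc : Vocabulary
  rel : ∀ {n : ℕ}, Rel n → (Fin n → Dom) → Prop
  rel_voc : ∀ {n : ℕ} (r : Rel n) (v : Fin n → Dom), rel r v → (⟨n, r⟩ : Letter) ∈ voc.letters

namespace Model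

instance (M : Model.{u}) : sig.Structure M.Dom where
  funMap := fun f => Empty.elim f
  RelMap := fun r v => M.rel r v

/-- The accessibility relation `R` of a model. -/
def R (M : Model.{u}) (a b : M.Dom) : Prop := M.rel Rel.R ![a, b]

/-- The relation `E` of a model. -/
def E (M : Model.{u}) (a b : M.Dom) : Prop := M.rel Rel.E ![a, b]

/-- `M, a, b₁, …, bₙ ⊨ φ(x, w₁, …, wₙ)`. The free variable `x` has index `0`, and `w₁, …, wₙ` have
the indices `1, …, n`. -/
def Sat (M : Model.{u}) {n : ℕ} (a : M.Dom) (b : Fin n → M.Dom) (φ : sig.Formula (Fin (n + 1))) :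
    Prop :=
  φ.Realize (Fin.cons a b : Fin (n + 1) → M.Dom)

/-- The reduct of `M` to the vocabulary `Θ` (used for `Θ ⊆ M.voc`). -/
def reduct (M : Model.{u}) (Θ : Vocabulary) : Model.{u} where
  Dom := M.Dom
  nonempty := M.nonempty
  voc := Θ
  rel := fun {n} r v => (⟨n, r⟩ : Letter) ∈ Θ.letters ∧ M.rel r v
  rel_voc := fun _ _ h => h.1

end Model

/-- Formulas of intuitionistic predicate logic without identity, over predicate letters `I k` of
arity `k` (for `k ≥ 0`), whose free variables are among `w₁, …, wₙ`. In `ex i` and `all i` the bound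
variable is the last one, `wₙ₊₁`. -/
inductive IntFormula (I : ℕ → Type v) : ℕ → Type v
  | atom {n k : ℕ} (p : I k) (w : Fin k → Fin n) : IntFormula I n
  | bot {n : ℕ} : IntFormula I n
  | and {n : ℕ} (i j : IntFormula I n) : IntFormula I n
  | or {n : ℕ} (i j : IntFormula I n) : IntFormula I n
  | imp {n : ℕ} (i j : IntFormula I n) : IntFormula I n
  | ex {n : ℕ} (i : IntFormula I (n + 1)) : IntFormula I n
  | all {n : ℕ} (i : IntFormula I (n + 1)) : IntFormula I n

/-- Variables of a formula with free variables in `α` and `m` variables bound so far. -/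
abbrev Var (α : Type) (m : ℕ) : Type := α ⊕ Fin m

/-- An old variable in the scope of one more quantifier. -/
def Var.lift {α : Type} {m : ℕ} : Var α m → Var α (m + 1) :=
  Sum.map id Fin.castSucc

/-- The variable bound by the innermost quantifier. -/
def Var.new {α : Type} {m : ℕ} : Var α (m + 1) := Sum.inr (Fin.last m)

/-- The atomic formula `r(v₁, …, vₖ)`. -/
def atomic {α : Type} {m k : ℕ} (r : Rel k) (v : Fin k → Var α m) : sig.BoundedFormula α m :=
  .rel (show sig.Relations k from r) (fun t => Language.Term.var (v t))

/-- The atomic formula `s = t` between variables. -/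
def eqVar {α : Type} {m : ℕ} (s t : Var α m) : sig.BoundedFormula α m :=
  .equal (Language.Term.var s) (Language.Term.var t)

/-- The standard translation `ST(i(w₁, …, wₙ), x)`, for arbitrary variables `x, w₁, …, wₙ`. The
`k`-ary intuitionistic letter `p` corresponds to the `(k + 1)`-ary letter `P k (tr k p)`. -/
def st {I : ℕ → Type v} (tr : ∀ k, I k → ℕ) {α : Type} : ∀ {n : ℕ}, IntFormula I n →
    ∀ {m : ℕ}, Var α m → (Fin n → Var α m) → sig.BoundedFormula α m
  | _, .atom (k := k) p u, _, x, w =>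
      atomic (Rel.P k (tr k p)) (Fin.cons x (fun t => w (u t)) : Fin (k + 1) → Var α _)
  | _, .bot, _, x, _ => ∼(eqVar x x)
  | _, .and i j, _, x, w => st tr i x w ⊓ st tr j x w
  | _, .or i j, _, x, w => st tr i x w ⊔ st tr j x w
  | _, .imp i j, _, x, w =>
      ∀' (atomic Rel.R ![x.lift, Var.new] ⟹
        (st tr i Var.new (fun t => (w t).lift) ⟹ st tr j Var.new (fun t => (w t).lift)))
  | n, .ex i, m, x, w =>
      ∃' (atomic Rel.E ![x.lift, Var.new] ⊓
        st tr i x.lift (Fin.snoc (fun t => (w t).lift) Var.new : Fin (n + 1) → Var α (m + 1)))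
  | n, .all i, m, x, w =>
      ∀' ∀' ((atomic Rel.R ![x.lift.lift, Var.new.lift] ⊓ atomic Rel.E ![Var.new.lift, Var.new]) ⟹
        st tr i Var.new.lift
          (Fin.snoc (fun t => (w t).lift.lift) Var.new : Fin (n + 1) → Var α (m + 2)))

/-- The standard `x`-translation of an intuitionistic formula `i(w₁, …, wₙ)`, as a formula in the
free variables `x` (index `0`) and `w₁, …, wₙ` (indices `1, …, n`). -/
def standardTranslation {I : ℕ → Type v} (tr : ∀ k, I k → ℕ) {n : ℕ} (i : IntFormula I n) :
    sig.Formula (Fin (n + 1)) :=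
  st tr i (m := 0) (Sum.inl 0) (fun t => Sum.inl t.succ)

/-- A set of pairs from `(D(M) × D(M)^l) × (D(N) × D(N)^l)`, `l ≥ 0`. -/
abbrev PointRel (M N : Model.{u}) : Type u :=
  ∀ l : ℕ, M.Dom → (Fin l → M.Dom) → N.Dom → (Fin l → N.Dom) → Prop

/-- The conditions on an asimulation for the case `α = M`, `β = N`; `A` is the part of the
asimulation that goes from `M` to `N`, and `B` is the part that goes from `N` to `M`. -/
structure AsimConditions (M N : Model.{u}) (A : PointRel M N) (B : PointRel N M) : Prop where
  atoms : ∀ {l : ℕ} {a : M.Dom} {b : Fin l → M.Dom} {c : N.Dom} {d : Fin l → N.Dom},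
    A l a b c d → ∀ (k m : ℕ), (⟨k + 1, Rel.P k m⟩ : Letter) ∈ M.voc.letters →
      ∀ u : Fin k → Fin l,
        M.rel (Rel.P k m) (Fin.cons a (fun t => b (u t)) : Fin (k + 1) → M.Dom) →
        N.rel (Rel.P k m) (Fin.cons c (fun t => d (u t)) : Fin (k + 1) → N.Dom)
  world : ∀ {l : ℕ} {a : M.Dom} {b : Fin l → M.Dom} {c : N.Dom} {d : Fin l → N.Dom},
    A l a b c d → ∀ c' : N.Dom, N.R c c' →
      ∃ a' : M.Dom, M.R a a' ∧ B l c' d a' b ∧ A l a' b c' d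
  object : ∀ {l : ℕ} {a : M.Dom} {b : Fin l → M.Dom} {c : N.Dom} {d : Fin l → N.Dom},
    A l a b c d → ∀ b' : M.Dom, M.E a b' →
      ∃ d' : N.Dom, N.E c d' ∧
        A (l + 1) a (Fin.snoc b b' : Fin (l + 1) → M.Dom) c (Fin.snoc d d' : Fin (l + 1) → N.Dom)
  worldObject : ∀ {l : ℕ} {a : M.Dom} {b : Fin l → M.Dom} {c : N.Dom} {d : Fin l → N.Dom},
    A l a b c d → ∀ c' d' : N.Dom, N.R c c' → N.E c' d' →
      ∃ a' b' : M.Dom, M.R a a' ∧ M.E a' b' ∧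
        A (l + 1) a' (Fin.snoc b b' : Fin (l + 1) → M.Dom) c' (Fin.snoc d d' : Fin (l + 1) → N.Dom)

/-- `A ∪ B` is an `⟨(M, a, b₁, …, bₙ), (N, c, d₁, …, dₙ)⟩`-asimulation, for two models with the same
vocabulary `Θ`. -/
structure IsAsimulation (M N : Model.{u}) {n : ℕ} (a : M.Dom) (b : Fin n → M.Dom)
    (c : N.Dom) (d : Fin n → N.Dom) (A : PointRel M N) (B : PointRel N M) : Prop where
  start : A n a b c d
  left : AsimConditions M N A B
  right : AsimConditions N M B A

/-- `K(Θ)`: the models in `K` with vocabulary `Θ`. -/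
def restrict (K : Set Model.{u}) (Θ : Vocabulary) : Set Model.{u} :=
  {M | M ∈ K ∧ M.voc = Θ}

/-- `K(Θ)` is first-order axiomatizable: for some set `Ax` of `Θ`-sentences, a `Θ`-model is in `K`
if and only if it is a model of `Ax`. -/
def Axiomatizable (K : Set Model.{u}) (Θ : Vocabulary) : Prop :=
  ∃ Ax : Set sig.Sentence, (∀ ψ ∈ Ax, IsFormulaOver Θ ψ) ∧
    ∀ M : Model.{u}, M.voc = Θ → (M ∈ restrict K Θ ↔ ∀ ψ ∈ Ax, M.Dom ⊨ ψ)

/-- `K(Θ)` is first-order axiomatizable for every finite vocabulary `Θ`. -/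
def FinitelyAxiomatizableParts (K : Set Model.{u}) : Prop :=
  ∀ Θ : Vocabulary, Θ.letters.Finite → Axiomatizable K Θ

/-- `K` is closed under reducts to finite vocabularies. -/
def ClosedUnderFiniteReducts (K : Set Model.{u}) : Prop :=
  ∀ M ∈ K, ∀ Θ : Vocabulary, Θ.letters.Finite → Θ.letters ⊆ M.voc.letters → M.reduct Θ ∈ K

/-- `Γ` is `K`-satisfiable: some model in `K` (whose vocabulary contains the letters of `Γ`)
satisfies `Γ` under some assignment. -/
def KSatisfiable (K : Set Model.{u}) {α : Type} (Γ : Set (sig.Formula α)) : Prop :=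
  ∃ M ∈ K, (∀ ψ ∈ Γ, IsFormulaOver M.voc ψ) ∧ ∃ f : α → M.Dom, ∀ ψ ∈ Γ, ψ.Realize f

/-- `Γ ⊨_K φ`. -/
def KFollows (K : Set Model.{u}) {α : Type} (Γ : Set (sig.Formula α)) (φ : sig.Formula α) : Prop :=
  ¬ KSatisfiable K (Γ ∪ {∼φ})

/-- `φ` and `ψ` are `K`-equivalent. -/
def KEquivalent (K : Set Model.{u}) {α : Type} (φ ψ : sig.Formula α) : Prop :=
  KFollows K {φ} ψ ∧ KFollows K {ψ} φ

/-- `φ(x, w₁, …, wₙ)` is `K`-invariant with respect to asimulations. -/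
def KInvariant (K : Set Model.{u}) {n : ℕ} (φ : sig.Formula (Fin (n + 1))) : Prop :=
  ∀ Θ : Vocabulary, (vocOf φ).letters ⊆ Θ.letters →
    ∀ M N : Model.{u}, M.voc = Θ → N.voc = Θ → M ∈ K → N ∈ K →
      ∀ (a : M.Dom) (b : Fin n → M.Dom) (c : N.Dom) (d : Fin n → N.Dom),
        (∃ (A : PointRel M N) (B : PointRel N M), IsAsimulation M N a b c d A B) →
        M.Sat a b φ → N.Sat c d φ

/-- An element `y` of a model is a world if `E(y, z)` for some `z`: every world has a non-empty
domain of objects. -/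
def Model.IsWorld (M : Model.{u}) (y : M.Dom) : Prop := ∃ z, M.E y z

/-- An element `z` of a model is an object if it is in the domain of some world. -/
def Model.IsObject (M : Model.{u}) (z : M.Dom) : Prop := ∃ y, M.E y z

/-- Intuitionistic (Kripke) models, as first-order models in which `R` is accessibility between
worlds and `E(y, z)` says that the object `z` is present in the world `y`. -/
structure Model.IsIntuitionistic (M : Model.{u}) : Prop where
  world_iff : ∀ x, M.IsWorld x ↔ ¬ M.IsObject x
  R_world : ∀ x y, M.R x y → M.IsWorld x ∧ M.IsWorld y
  R_refl : ∀ y, M.IsWorld y → M.R y y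
  R_trans : ∀ x y z, M.R x y → M.R y z → M.R x z
  E_mono : ∀ y z w, M.E y w → M.R y z → M.E z w
  P_mono : ∀ (k m : ℕ) (y z : M.Dom) (w : Fin k → M.Dom),
    M.rel (Rel.P k m) (Fin.cons y w : Fin (k + 1) → M.Dom) → M.R y z →
      M.rel (Rel.P k m) (Fin.cons z w : Fin (k + 1) → M.Dom)
  P_type : ∀ (k m : ℕ) (y : M.Dom) (w : Fin k → M.Dom),
    M.rel (Rel.P k m) (Fin.cons y w : Fin (k + 1) → M.Dom) → ∀ t, M.E y (w t)

/-- The class of all intuitionistic models. -/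
def intModels : Set Model.{u} := {M | M.IsIntuitionistic}

/-- The class of all intuitionistic models with constant domains: every object is present in every
world. -/
def constDomainModels : Set Model.{u} :=
  {M | M.IsIntuitionistic ∧ ∀ z, M.IsObject z → ∀ y, M.IsWorld y → M.E y z}

end PredAsim

open PredAsim

open PredAsim

namespace PredAsim

open Filter FirstOrder.Language

/-! ### Semantics of the standard translation -/

/-! The argument follows van Benthem's characterization of modal formulas. `Model.Forces` unfolds
the standard translation into Kripke-style clauses, and `AsimConditions.forces` shows by induction
that asimulations preserve it; this gives the easy direction.

For the converse, work inside K(Σ_φ). Since Σ_φ is finite, this class is axiomatizable, hence closed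
under ultraproducts by Łoś's theorem. All the model theory rests on ultraproducts over a
non-principal ultrafilter on ℕ. The signature is countable, so they yield compactness
(`Axiomatizable.compactness`), and their countable types over finitely many parameters are realized
(`Model.ultra_isSaturated`). Between saturated models the relation "every intuitionistic formula
true on the left is true on the right" (`IntLe`) is itself an asimulation (`IntLe.asimConditions`).
Passing to ultrapowers, an invariant φ is therefore preserved along `IntLe` between arbitrary
members of K(Σ_φ) (`KInvariant.sat_of_intLe`). Two applications of compactness then produce a single
intuitionistic formula equivalent to φ on K(Σ_φ) (`KInvariant.exists_intFormula`).

That formula may contain foreign letters. They are empty in Σ_φ-models, so their atoms can be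
replaced by ⊥, and closure of K under finite reducts extends the equivalence to all of K. For the
two concrete classes, the defining conditions are written out as first-order axioms. -/

@[simp] lemma realize_atomic {M : Model.{u}} {α : Type} {m k : ℕ} (r : Rel k)
    (w : Fin k → Var α m) (f : α → M.Dom) (xs : Fin m → M.Dom) :
    (atomic r w).Realize f xs ↔ M.rel r (fun t => Sum.elim f xs (w t)) := Iff.rfl

@[simp] lemma realize_eqVar {M : Model.{u}} {α : Type} {m : ℕ} (s t : Var α m)
    (f : α → M.Dom) (xs : Fin m → M.Dom) :
    (eqVar s t).Realize f xs ↔ Sum.elim f xs s = Sum.elim f xs t := Iff.rfl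

lemma rel_pair_iff {M : Model.{u}} {ι : Type} (r : Rel 2) (s : ι → M.Dom) (x y : ι) :
    M.rel r (fun t => s (![x, y] t)) ↔ M.rel r ![s x, s y] := by
  have : (fun t => s (![x, y] t)) = ![s x, s y] := by
    funext t; fin_cases t <;> rfl
  rw [this]

@[simp] lemma elim_snoc_lift {D : Type u} {α : Type} {m : ℕ} (f : α → D) (xs : Fin m → D) (y : D)
    (x : Var α m) :
    Sum.elim f (Fin.snoc xs y : Fin (m + 1) → D) x.lift = Sum.elim f xs x := by
  rcases x with x | x <;> simp [Var.lift]

@[simp] lemma elim_snoc_new {D : Type u} {α : Type} {m : ℕ} (f : α → D) (xs : Fin m → D) (y : D) :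
    Sum.elim f (Fin.snoc xs y : Fin (m + 1) → D) (Var.new : Var α (m + 1)) = y := by
  simp [Var.new]

/-- Satisfaction of an intuitionistic formula at a point of a model, defined so that it agrees with
the truth of the standard translation. -/
def Model.Forces (M : Model.{u}) {I : ℕ → Type v} (tr : ∀ k, I k → ℕ) :
    ∀ {n : ℕ}, IntFormula I n → M.Dom → (Fin n → M.Dom) → Prop
  | _, .atom (k := k) p w, a, b =>
      M.rel (Rel.P k (tr k p)) (Fin.cons a (fun t => b (w t)) : Fin (k + 1) → M.Dom)
  | _, .bot, _, _ => False
  | _, .and i j, a, b => M.Forces tr i a b ∧ M.Forces tr j a b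
  | _, .or i j, a, b => M.Forces tr i a b ∨ M.Forces tr j a b
  | _, .imp i j, a, b => ∀ y, M.R a y → M.Forces tr i y b → M.Forces tr j y b
  | n, .ex i, a, b => ∃ w, M.E a w ∧ M.Forces tr i a (Fin.snoc b w : Fin (n + 1) → M.Dom)
  | n, .all i, a, b => ∀ y w, M.R a y → M.E y w →
      M.Forces tr i y (Fin.snoc b w : Fin (n + 1) → M.Dom)

lemma apply_snoc {D : Type u} {ι : Type} {n : ℕ} (g : ι → D) (w : Fin n → ι) (x : ι) :
    (fun t => g ((Fin.snoc w x : Fin (n + 1) → ι) t)) =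
      (Fin.snoc (fun t => g (w t)) (g x) : Fin (n + 1) → D) := by
  funext t
  refine Fin.lastCases ?_ (fun t => ?_) t <;> simp

lemma realize_st {M : Model.{u}} {I : ℕ → Type v} (tr : ∀ k, I k → ℕ) {α : Type} (f : α → M.Dom)
    {n : ℕ} (i : IntFormula I n) : ∀ {m : ℕ} (xs : Fin m → M.Dom) (x : Var α m)
      (w : Fin n → Var α m),
      (st tr i x w).Realize f xs ↔
        M.Forces tr i (Sum.elim f xs x) (fun t => Sum.elim f xs (w t)) := by
  induction i with
  | atom p u =>
    intro m xs x w
    have : (fun t => Sum.elim f xs ((Fin.cons x (fun t => w (u t)) : Fin (_ + 1) → Var α m) t)) =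
        (Fin.cons (Sum.elim f xs x) (fun t => Sum.elim f xs (w (u t))) : Fin (_ + 1) → M.Dom) := by
      funext t
      refine Fin.cases ?_ (fun t => ?_) t <;> rfl
    simp only [st, realize_atomic, Model.Forces, this]
  | bot => intro m xs x w; simp [st, Model.Forces]
  | and i j hi hj => intro m xs x w; simp [st, Model.Forces, hi, hj]
  | or i j hi hj => intro m xs x w; simp [st, Model.Forces, hi, hj]
  | imp i j hi hj =>
    intro m xs x w
    simp [st, Model.Forces, hi, hj, rel_pair_iff, Model.R]
  | ex i hi =>
    intro m xs x w
    simp [st, Model.Forces, hi, rel_pair_iff, Model.E, apply_snoc]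
  | all i hi =>
    intro m xs x w
    simp only [st, Model.Forces, hi, rel_pair_iff, apply_snoc, BoundedFormula.realize_all,
      BoundedFormula.realize_imp, BoundedFormula.realize_inf, realize_atomic, elim_snoc_lift,
      elim_snoc_new, and_imp]
    rfl

lemma sat_standardTranslation {M : Model.{u}} {I : ℕ → Type v} (tr : ∀ k, I k → ℕ) {n : ℕ}
    (i : IntFormula I n) (a : M.Dom) (b : Fin n → M.Dom) :
    M.Sat a b (standardTranslation tr i) ↔ M.Forces tr i a b := by
  simp [Model.Sat, standardTranslation, Formula.Realize, realize_st]

/-! ### Letters of formulas -/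

section Letters
variable {α : Type} {m : ℕ}

@[simp] lemma letters_imp (φ ψ : sig.BoundedFormula α m) :
    letters (φ ⟹ ψ) = letters φ ∪ letters ψ := rfl

@[simp] lemma letters_not (φ : sig.BoundedFormula α m) : letters (∼φ) = letters φ :=
  Set.union_empty _

@[simp] lemma letters_inf (φ ψ : sig.BoundedFormula α m) :
    letters (φ ⊓ ψ) = letters φ ∪ letters ψ := by
  change letters (∼(φ ⟹ ∼ψ)) = _
  simp

@[simp] lemma letters_sup (φ ψ : sig.BoundedFormula α m) :
    letters (φ ⊔ ψ) = letters φ ∪ letters ψ := by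
  change letters (∼φ ⟹ ψ) = _
  simp

@[simp] lemma letters_all (φ : sig.BoundedFormula α (m + 1)) : letters (∀' φ) = letters φ := rfl

@[simp] lemma letters_ex (φ : sig.BoundedFormula α (m + 1)) : letters (∃' φ) = letters φ := by
  change letters (∼(∀' ∼φ)) = _
  simp

@[simp] lemma letters_atomic {k : ℕ} (r : Rel k) (v : Fin k → Var α m) :
    letters (atomic r v) = {(⟨k, r⟩ : Letter)} := rfl

@[simp] lemma letters_eqVar (s t : Var α m) : letters (eqVar s t) = ∅ := rfl

lemma letters_alls : ∀ {m : ℕ} (φ : sig.BoundedFormula α m), letters φ.alls = letters φ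
  | 0, _ => rfl
  | _ + 1, φ => (letters_alls (∀' φ)).trans rfl

lemma letters_finite : ∀ {m : ℕ} (φ : sig.BoundedFormula α m), (letters φ).Finite
  | _, .falsum => Set.finite_empty
  | _, .equal _ _ => Set.finite_empty
  | _, .rel _ _ => Set.finite_singleton _
  | _, .imp φ ψ => (letters_finite φ).union (letters_finite ψ)
  | _, .all φ => letters_finite φ

lemma vocOf_finite (φ : sig.Formula α) : (vocOf φ).letters.Finite :=
  ((Set.finite_singleton _).insert _).union (letters_finite φ)

lemma vocOf_subset {φ : sig.Formula α} {Θ : Vocabulary} (h : IsFormulaOver Θ φ) :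
    (vocOf φ).letters ⊆ Θ.letters := by
  rintro l ((rfl | rfl) | hl)
  exacts [Θ.R_mem, Θ.E_mem, h hl]

lemma realize_reduct (M : Model.{u}) (Θ : Vocabulary) {m : ℕ} (φ : sig.BoundedFormula α m)
    (h : letters φ ⊆ Θ.letters) (f : α → M.Dom) (xs : Fin m → M.Dom) :
    φ.Realize (M := (M.reduct Θ).Dom) f xs ↔ φ.Realize (M := M.Dom) f xs := by
  have term (n : ℕ) (g : Fin n → M.Dom) (t : sig.Term (α ⊕ Fin n)) :
      t.realize (M := (M.reduct Θ).Dom) (Sum.elim f g) =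
        t.realize (M := M.Dom) (Sum.elim f g) := by
    cases t with
    | var => rfl
    | func g => exact g.elim
  induction φ with
  | falsum => rfl
  | equal s t =>
    change (s.realize (M := (M.reduct Θ).Dom) _ = t.realize (M := (M.reduct Θ).Dom) _) ↔ _
    rw [term, term]; rfl
  | rel r ts =>
    have hr : (⟨_, r⟩ : Letter) ∈ Θ.letters := h rfl
    change (_ ∧ M.rel r (fun t => (ts t).realize (M := (M.reduct Θ).Dom) _)) ↔ _
    simp only [term, hr, true_and]; rfl
  | imp φ ψ hφ hψ =>
    have h' := Set.union_subset_iff.1 h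
    exact imp_congr (hφ h'.1 xs) (hψ h'.2 xs)
  | all φ hφ => exact forall_congr' fun a => hφ h _

end Letters

/-! ### Invariance under asimulations -/

/-- The induction keeps both models and both directions `A`, `B` general. In the implication case
the antecedent has to travel backwards along `B`, which exchanges the roles of the models. -/
lemma AsimConditions.forces {I : ℕ → Type v} (tr : ∀ k, I k → ℕ) {l : ℕ} (i : IntFormula I l) :
    ∀ {M N : Model.{u}} {A : PointRel M N} {B : PointRel N M}, M.voc = N.voc →
      AsimConditions M N A B → AsimConditions N M B A →
      ∀ {a : M.Dom} {b : Fin l → M.Dom} {c : N.Dom} {d : Fin l → N.Dom}, A l a b c d →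
        M.Forces tr i a b → N.Forces tr i c d := by
  induction i with
  | atom p w => exact fun _ hA _ _ _ _ _ h hf => hA.atoms h _ _ (Model.rel_voc _ _ _ hf) _ hf
  | bot => exact fun _ _ _ _ _ _ _ _ hf => hf
  | and i j hi hj =>
    exact fun e hA hB _ _ _ _ h hf => ⟨hi e hA hB h hf.1, hj e hA hB h hf.2⟩
  | or i j hi hj =>
    exact fun e hA hB _ _ _ _ h hf => hf.imp (hi e hA hB h) (hj e hA hB h)
  | imp i j hi hj =>
    intro M N A B e hA hB a b c d h hf c' hc hi'
    obtain ⟨a', ha, h₁, h₂⟩ := hA.world h c' hc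
    exact hj e hA hB h₂ (hf a' ha (hi e.symm hB hA h₁ hi'))
  | ex i hi =>
    rintro M N A B e hA hB a b c d h ⟨w, hw, hf⟩
    obtain ⟨d', hd, h'⟩ := hA.object h w hw
    exact ⟨d', hd, hi e hA hB h' hf⟩
  | all i hi =>
    intro M N A B e hA hB a b c d h hf c' d' hc hd
    obtain ⟨a', b', ha, hb, h'⟩ := hA.worldObject h c' d' hc hd
    exact hi e hA hB h' (hf a' b' ha hb)

/-! ### Operations on intuitionistic formulas -/

open Classical in
/-- Replace the atoms with letters outside of `Θ` by `⊥`. -/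
noncomputable def IntFormula.relativize {I : ℕ → Type v} (tr : ∀ k, I k → ℕ) (Θ : Vocabulary) :
    ∀ {n : ℕ}, IntFormula I n → IntFormula I n
  | _, .atom (k := k) p w =>
      if (⟨k + 1, Rel.P k (tr k p)⟩ : Letter) ∈ Θ.letters then .atom p w else .bot
  | _, .bot => .bot
  | _, .and i j => .and (i.relativize tr Θ) (j.relativize tr Θ)
  | _, .or i j => .or (i.relativize tr Θ) (j.relativize tr Θ)
  | _, .imp i j => .imp (i.relativize tr Θ) (j.relativize tr Θ)
  | _, .ex i => .ex (i.relativize tr Θ)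
  | _, .all i => .all (i.relativize tr Θ)

section Relativize
variable {I : ℕ → Type v} (tr : ∀ k, I k → ℕ) (Θ : Vocabulary)

lemma letters_st_relativize {α : Type} {n : ℕ} (i : IntFormula I n) :
    ∀ {m : ℕ} (x : Var α m) (w : Fin n → Var α m),
      letters (st tr (i.relativize tr Θ) x w) ⊆ Θ.letters := by
  induction i with
  | @atom _ k p u =>
    intro m x w
    by_cases h : (⟨k + 1, Rel.P k (tr k p)⟩ : Letter) ∈ Θ.letters
    · simp [IntFormula.relativize, h, st]
    · simp [IntFormula.relativize, h, st]
  | bot => intro m x w; simp [IntFormula.relativize, st]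
  | and i j hi hj => intro m x w; simp [IntFormula.relativize, st, hi, hj]
  | or i j hi hj => intro m x w; simp [IntFormula.relativize, st, hi, hj]
  | imp i j hi hj => intro m x w; simp [IntFormula.relativize, st, hi, hj, Θ.R_mem, Set.insert_subset_iff]
  | ex i hi => intro m x w; simp [IntFormula.relativize, st, hi, Θ.E_mem, Set.insert_subset_iff]
  | all i hi =>
    intro m x w
    simp [IntFormula.relativize, st, hi, Θ.R_mem, Θ.E_mem, Set.insert_subset_iff]

/-- In a Θ-model a letter outside Θ has the empty interpretation, so its atoms are as false as ⊥. -/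
lemma forces_relativize {M : Model.{u}} (hM : M.voc = Θ) {n : ℕ} (i : IntFormula I n) :
    ∀ (a : M.Dom) (b : Fin n → M.Dom),
      M.Forces tr (i.relativize tr Θ) a b ↔ M.Forces tr i a b := by
  induction i with
  | @atom _ k p u =>
    intro a b
    by_cases h : (⟨k + 1, Rel.P k (tr k p)⟩ : Letter) ∈ Θ.letters
    · simp [IntFormula.relativize, h]
    · simp only [IntFormula.relativize, h, if_false, Model.Forces, false_iff]
      exact fun hr => h (hM ▸ M.rel_voc _ _ hr)
  | bot => exact fun _ _ => Iff.rfl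
  | and i j hi hj => intro a b; simp [IntFormula.relativize, Model.Forces, hi, hj]
  | or i j hi hj => intro a b; simp [IntFormula.relativize, Model.Forces, hi, hj]
  | imp i j hi hj => intro a b; simp [IntFormula.relativize, Model.Forces, hi, hj]
  | ex i hi => intro a b; simp [IntFormula.relativize, Model.Forces, hi]
  | all i hi => intro a b; simp [IntFormula.relativize, Model.Forces, hi]

end Relativize

/-! ### Finite conjunctions and disjunctions, uniform in the model -/

section Connectives
variable {I : ℕ → Type v} (tr : ∀ k, I k → ℕ) {n : ℕ}

lemma exists_conj (S : Finset (IntFormula I n)) : ∃ i : IntFormula I n,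
    ∀ (M : Model.{u}) (a : M.Dom) (b : Fin n → M.Dom),
      M.Forces tr i a b ↔ ∀ j ∈ S, M.Forces tr j a b := by
  classical
  induction S using Finset.induction_on with
  -- The syntax has no ⊤; `⊥ → ⊥` serves as the empty conjunction.
  | empty => exact ⟨.imp .bot .bot, fun M a b => by simp [Model.Forces]⟩
  | insert j S _ ih =>
    obtain ⟨i, hi⟩ := ih
    exact ⟨.and j i, fun M a b => by simp [Model.Forces, hi]⟩

lemma exists_disj (S : Finset (IntFormula I n)) : ∃ i : IntFormula I n,
    ∀ (M : Model.{u}) (a : M.Dom) (b : Fin n → M.Dom),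
      M.Forces tr i a b ↔ ∃ j ∈ S, M.Forces tr j a b := by
  classical
  induction S using Finset.induction_on with
  | empty => exact ⟨.bot, fun M a b => by simp [Model.Forces]⟩
  | insert j S _ ih =>
    obtain ⟨i, hi⟩ := ih
    exact ⟨.or j i, fun M a b => by simp [Model.Forces, hi]⟩

end Connectives

/-! ### Ultraproducts over a non-principal ultrafilter on `ℕ` -/

/-- Diagonal argument: an increasing family of requirements, each of which can be met almost
everywhere, can be met by a single sequence. -/
lemma exists_diagonal {X : ℕ → Type u} [∀ n, Nonempty (X n)] (Q : ℕ → ∀ n, X n → Prop)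
    (h : ∀ k, ∀ᶠ n in (hyperfilter ℕ : Filter ℕ), ∃ w, ∀ j ≤ k, Q j n w) :
    ∃ w : ∀ n, X n, ∀ j, ∀ᶠ n in (hyperfilter ℕ : Filter ℕ), Q j n (w n) := by
  classical
  -- At index `n`, choose a witness for the longest initial segment of requirements, with bound at
  -- most `n`, that can be met there. Requirement `j` is then met at every `n ≥ j` where
  -- requirements `0, …, j` are jointly satisfiable, hence almost everywhere.
  have hmax (n : ℕ) : ∃ w : X n, ∀ k ≤ n, (∃ w, ∀ j ≤ k, Q j n w) → ∀ j ≤ k, Q j n w := by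
    let S := (Finset.range (n + 1)).filter (fun k => ∃ w, ∀ j ≤ k, Q j n w)
    rcases S.eq_empty_or_nonempty with hS | hS
    · refine ⟨Classical.arbitrary _, fun k hk hw => ?_⟩
      have : k ∈ S := by simp only [S, Finset.mem_filter, Finset.mem_range]; exact ⟨by omega, hw⟩
      simp [hS] at this
    · obtain ⟨w, hw⟩ := (Finset.mem_filter.1 (S.max'_mem hS)).2
      refine ⟨w, fun k hk hk' j hj => hw j (hj.trans (S.le_max' k ?_))⟩
      simp only [S, Finset.mem_filter, Finset.mem_range]
      exact ⟨by omega, hk'⟩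
  choose w hw using hmax
  refine ⟨w, fun j => ?_⟩
  have hj : ∀ᶠ n in (hyperfilter ℕ : Filter ℕ), j ≤ n :=
    (Nat.hyperfilter_le_atTop) (eventually_ge_atTop j)
  filter_upwards [h j, hj] with n h₁ h₂
  exact hw n j h₂ h₁ j le_rfl

/-- This makes the formulas in countably many variables countable, so that sequences of models
suffice for compactness and saturation even when the intuitionistic letters are uncountable in
number. -/
instance : Countable sig.Symbols := by
  have : Countable (Σ n, sig.Functions n) := ⟨fun x => x.2.elim, fun x => x.2.elim⟩
  have : Countable (Σ n, sig.Relations n) := by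
    refine Function.Injective.countable (β := Option (Option (ℕ × ℕ)))
      (f := fun x => match x with
        | ⟨_, Rel.R⟩ => none
        | ⟨_, Rel.E⟩ => some none
        | ⟨_, Rel.P k m⟩ => some (some (k, m))) ?_
    rintro ⟨_, _ | _ | _⟩ ⟨_, _ | _ | _⟩ h <;> simp_all
    obtain ⟨rfl, rfl⟩ := h
    rfl
  exact inferInstanceAs (Countable (_ ⊕ _))

namespace Model

instance (M : Model.{u}) : Nonempty M.Dom := M.nonempty

variable (M : ℕ → Model.{u}) (Θ : Vocabulary) (hM : ∀ n, (M n).voc = Θ)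

/-- The ultraproduct of a sequence of `Θ`-models. -/
noncomputable def ultra : Model.{u} where
  Dom := (hyperfilter ℕ : Filter ℕ).Product (fun n => (M n).Dom)
  nonempty := inferInstance
  voc := Θ
  rel := fun {k} r v =>
    Structure.RelMap (L := sig) (M := (hyperfilter ℕ : Filter ℕ).Product (fun n => (M n).Dom))
      (show sig.Relations k from r) v
  rel_voc := fun {k} r v h => by
    obtain ⟨w, rfl⟩ : ∃ w : Fin k → ∀ n, (M n).Dom,
        (fun i => (w i : (hyperfilter ℕ : Filter ℕ).Product (fun n => (M n).Dom))) = v :=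
      ⟨fun i => (v i).out, funext fun i => Quotient.out_eq _⟩
    have := (relMap_quotient_mk' (L := sig) (s := (hyperfilter ℕ : Filter ℕ).productSetoid _)
      (show sig.Relations k from r) w).1 h
    obtain ⟨n, hn⟩ := Eventually.exists (f := (hyperfilter ℕ : Filter ℕ)) this
    exact hM n ▸ (M n).rel_voc r _ hn

/-- The element of the ultraproduct that is given by a sequence of elements. -/
noncomputable def ultraMk (w : ∀ n, (M n).Dom) : (ultra M Θ hM).Dom :=
  (w : (hyperfilter ℕ : Filter ℕ).Product (fun n => (M n).Dom))

lemma ultraMk_surjective {α : Type} (v : α → (ultra M Θ hM).Dom) :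
    ∃ w : α → ∀ n, (M n).Dom, v = fun i => ultraMk M Θ hM (w i) :=
  ⟨fun i => (v i).out, funext fun i => (Quotient.out_eq (v i)).symm⟩

/-- This is Łoś's theorem. It applies because the structure that `ultra` carries as a `Model` is the
ultraproduct structure: there are no function symbols, and the relations agree by definition. -/
lemma ultra_realize {α : Type} (φ : sig.Formula α) (w : α → ∀ n, (M n).Dom) :
    φ.Realize (fun i => ultraMk M Θ hM (w i)) ↔
      ∀ᶠ n in (hyperfilter ℕ : Filter ℕ), φ.Realize (fun i => w i n) := by
  rw [← Ultraproduct.realize_formula_cast]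
  have : (inferInstance : sig.Structure (ultra M Θ hM).Dom) =
      (Ultraproduct.structure :
        sig.Structure ((hyperfilter ℕ : Filter ℕ).Product (fun n => (M n).Dom))) := by
    apply Structure.ext
    · funext n f; exact f.elim
    · rfl
  change @Formula.Realize _ _ (inferInstance : sig.Structure (ultra M Θ hM).Dom) _ _ _ ↔ _
  rw [this]
  rfl

lemma ultra_models (ψ : sig.Sentence) :
    (ultra M Θ hM).Dom ⊨ ψ ↔ ∀ᶠ n in (hyperfilter ℕ : Filter ℕ), (M n).Dom ⊨ ψ := by
  have := ultra_realize M Θ hM (α := Empty) ψ (fun x => x.elim)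
  simp only [Sentence.Realize]
  convert this using 3
  all_goals congr! 1

end Model

/-- The axioms hold in every factor, so Łoś's theorem carries them to the ultraproduct. -/
lemma Axiomatizable.ultra_mem {K : Set Model.{u}} {Θ : Vocabulary} (hK : Axiomatizable K Θ)
    {M : ℕ → Model.{u}} (hM : ∀ n, M n ∈ restrict K Θ) :
    Model.ultra M Θ (fun n => (hM n).2) ∈ restrict K Θ := by
  obtain ⟨Ax, -, h⟩ := hK
  refine (h _ rfl).2 fun ψ hψ => (Model.ultra_models ..).2 (.of_forall fun n => ?_)
  exact (h _ (hM n).2).1 (hM n) ψ hψ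

/-- A family of formulas in countably many variables takes only countably many values. -/
lemma exists_enumeration {α : Type} [Countable α] {ι : Type v} [Nonempty ι]
    (γ : ι → sig.Formula α) : ∃ e : ℕ → ι, ∀ i, ∃ k, γ (e k) = γ i := by
  obtain ⟨g, hg⟩ := (Set.to_countable (Set.range γ)).exists_eq_range (Set.range_nonempty γ)
  have (k : ℕ) : ∃ i, γ i = g k := by
    have : g k ∈ Set.range γ := hg ▸ Set.mem_range_self k
    exact this
  choose e he using this
  refine ⟨e, fun i => ?_⟩
  obtain ⟨k, hk⟩ : γ i ∈ Set.range g := hg ▸ Set.mem_range_self i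
  exact ⟨k, (he k).trans hk⟩

/-- Compactness inside an axiomatizable class of `Θ`-models. -/
lemma Axiomatizable.compactness {K : Set Model.{u}} {Θ : Vocabulary} (hK : Axiomatizable K Θ)
    {α : Type} [Countable α] {ι : Type v} [Nonempty ι] (γ : ι → sig.Formula α)
    (h : ∀ S : Finset ι, ∃ M ∈ restrict K Θ, ∃ f : α → M.Dom, ∀ i ∈ S, (γ i).Realize f) :
    ∃ M ∈ restrict K Θ, ∃ f : α → M.Dom, ∀ i, (γ i).Realize f := by
  classical
  obtain ⟨e, he⟩ := exists_enumeration γ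
  -- The `n`-th model satisfies the formulas with numbers `0, …, n`, so each formula holds in all
  -- but finitely many factors.
  choose M hM f hf using fun n : ℕ => h ((Finset.range (n + 1)).image e)
  refine ⟨_, hK.ultra_mem hM, fun i => Model.ultraMk M Θ _ (fun n => f n i), fun i => ?_⟩
  obtain ⟨k, hk⟩ := he i
  rw [← hk, Model.ultra_realize]
  filter_upwards [Nat.hyperfilter_le_atTop (eventually_ge_atTop k)] with n hn
  exact hf n _ (Finset.mem_image_of_mem _ (by simp; omega))

/-- Finitely satisfiable types over finitely many parameters are realized. -/
def Model.IsSaturated (M : Model.{u}) : Prop :=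
  ∀ (l k : ℕ) (ι : Type v) [Nonempty ι] (v : Fin l → M.Dom)
    (γ : ι → sig.Formula (Fin l ⊕ Fin k)),
    (∀ S : Finset ι, ∃ w : Fin k → M.Dom, ∀ i ∈ S, (γ i).Realize (Sum.elim v w)) →
      ∃ w : Fin k → M.Dom, ∀ i, (γ i).Realize (Sum.elim v w)

/-- By Łoś's theorem, each finite part of the type is satisfiable in almost every factor, with the
parameters replaced by representatives. The diagonal argument assembles these local witnesses into
one sequence. -/
lemma Model.ultra_isSaturated (M : ℕ → Model.{u}) (Θ : Vocabulary) (hM : ∀ n, (M n).voc = Θ) :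
    Model.IsSaturated.{u, v} (Model.ultra M Θ hM) := by
  classical
  intro l k ι _ v γ h
  obtain ⟨e, he⟩ := exists_enumeration γ
  obtain ⟨v, rfl⟩ := ultraMk_surjective M Θ hM v
  have key (i : ι) (w : Fin k → ∀ n, (M n).Dom) :
      (γ i).Realize (Sum.elim (fun i => ultraMk M Θ hM (v i)) (fun i => ultraMk M Θ hM (w i))) ↔
        ∀ᶠ n in (hyperfilter ℕ : Filter ℕ),
          (γ i).Realize (Sum.elim (fun i => v i n) (fun i => w i n)) := by
    have := ultra_realize M Θ hM (γ i) (Sum.elim v w)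
    convert this using 2
    · ext x; rcases x with x | x <;> rfl
    · ext x; congr! 1; ext x; rcases x with x | x <;> rfl
  obtain ⟨w, hw⟩ := exists_diagonal (X := fun n => Fin k → (M n).Dom)
    (fun j n w => (γ (e j)).Realize (Sum.elim (fun i => v i n) w)) (fun m => by
      obtain ⟨w, hw⟩ := h ((Finset.range (m + 1)).image e)
      obtain ⟨w, rfl⟩ := ultraMk_surjective M Θ hM w
      have : ∀ᶠ n in (hyperfilter ℕ : Filter ℕ), ∀ j ∈ Finset.range (m + 1),
          (γ (e j)).Realize (Sum.elim (fun i => v i n) (fun i => w i n)) :=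
        (Finset.eventually_all _).2 fun j hj => (key _ _).1 (hw _ (Finset.mem_image_of_mem _ hj))
      filter_upwards [this] with n hn
      exact ⟨fun i => w i n, fun j hj => hn j (by simp; omega)⟩)
  refine ⟨fun i => ultraMk M Θ hM (fun n => w n i), fun i => ?_⟩
  obtain ⟨m, hm⟩ := he i
  rw [← hm, key]
  exact hw m

/-! ### Saturated models -/

section Saturated
variable {I : ℕ → Type v} (tr : ∀ k, I k → ℕ)

/-- Every intuitionistic formula that is true at the left point is true at the right point. -/
def IntLe (M N : Model.{u}) : PointRel M N := fun l a b c d =>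
  ∀ i : IntFormula I l, M.Forces tr i a b → N.Forces tr i c d

instance (l : ℕ) : Nonempty (IntFormula I l) := ⟨.bot⟩

/-- The point parameters followed by the realization of a type. -/
lemma elim_cons_snoc {M : Model.{u}} {l k : ℕ} (a : M.Dom) (b : Fin l → M.Dom) (w : Fin k → M.Dom)
    (xs : Fin 0 → M.Dom) (y : Fin k) :
    (fun t => Sum.elim (Sum.elim (Fin.cons a b : Fin (l + 1) → M.Dom) w) xs
      ((Fin.snoc (fun t => Sum.inl (Sum.inl t.succ)) (Sum.inl (Sum.inr y)) :
        Fin (l + 1) → Var (Fin (l + 1) ⊕ Fin k) 0) t)) =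
      (Fin.snoc b (w y) : Fin (l + 1) → M.Dom) := by
  rw [apply_snoc]
  simp

open Classical in
-- The type to realize in `M` says that `y` is an `R`-successor of `a` with exactly the
-- intuitionistic theory of `c'`; both inclusions are required, since the clause asks for the
-- relation in both directions.
lemma IntLe.world_step {M N : Model.{u}} (hM : Model.IsSaturated.{u, v} M) {l : ℕ} {a : M.Dom}
    {b : Fin l → M.Dom} {c : N.Dom} {d : Fin l → N.Dom} (h : IntLe tr M N l a b c d)
    (c' : N.Dom) (hc : N.R c c') :
    ∃ a' : M.Dom, M.R a a' ∧ IntLe tr N M l c' d a' b ∧ IntLe tr M N l a' b c' d := by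
  let α := Fin (l + 1) ⊕ Fin 1
  let x : Var α 0 := Sum.inl (Sum.inl 0)
  let y : Var α 0 := Sum.inl (Sum.inr 0)
  let F (i : IntFormula I l) : sig.Formula α := st tr i y (fun t => Sum.inl (Sum.inl t.succ))
  let γ (i : IntFormula I l) : sig.Formula α :=
    atomic Rel.R ![x, y] ⊓ (if N.Forces tr i c' d then F i else ∼(F i))
  have key (w : Fin 1 → M.Dom) (i : IntFormula I l) :
      (γ i).Realize (Sum.elim (Fin.cons a b) w) ↔
        M.R a (w 0) ∧ (M.Forces tr i (w 0) b ↔ N.Forces tr i c' d) := by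
    by_cases hi : N.Forces tr i c' d <;>
      simp [γ, F, hi, Formula.Realize, realize_st, rel_pair_iff, x, y, Model.R]
  obtain ⟨w, hw⟩ := hM (l + 1) 1 _ (Fin.cons a b) γ (fun S => by
    obtain ⟨p, hp⟩ := exists_conj.{u} tr (S.filter fun i => N.Forces tr i c' d)
    obtain ⟨q, hq⟩ := exists_disj.{u} tr (S.filter fun i => ¬ N.Forces tr i c' d)
    -- Otherwise `IntLe` would carry `p → q` to `(c, d)`, where `c'` refutes it. A successor of `a`
    -- refuting it realizes the finite part `S`.
    have hn : ¬ M.Forces tr (.imp p q) a b := fun hf => by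
      have := h _ hf c' hc ((hp ..).2 fun j hj => (Finset.mem_filter.1 hj).2)
      obtain ⟨j, hj, hf⟩ := (hq ..).1 this
      exact (Finset.mem_filter.1 hj).2 hf
    simp only [Model.Forces, not_forall] at hn
    obtain ⟨a', ha, h₁, h₂⟩ := hn
    refine ⟨fun _ => a', fun i hi => (key _ i).2 ⟨ha, ?_⟩⟩
    by_cases hf : N.Forces tr i c' d
    · exact iff_of_true ((hp ..).1 h₁ i (Finset.mem_filter.2 ⟨hi, hf⟩)) hf
    · exact iff_of_false (fun h' => h₂ ((hq ..).2 ⟨i, Finset.mem_filter.2 ⟨hi, hf⟩, h'⟩)) hf)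
  simp only [key] at hw
  -- Each formula of the type contains the atom for `R`, so any index yields it; `.bot` is an
  -- arbitrary choice.
  exact ⟨w 0, (hw .bot).1, fun i => (hw i).2.2, fun i => (hw i).2.1⟩

open Classical in
-- Here the type is realized in `N`. A finite part with conjunction `p` is satisfiable because `∃w
-- p` is true at `a`, hence at `c`.
lemma IntLe.object_step {M N : Model.{u}} (hN : Model.IsSaturated.{u, v} N) {l : ℕ} {a : M.Dom}
    {b : Fin l → M.Dom} {c : N.Dom} {d : Fin l → N.Dom} (h : IntLe tr M N l a b c d)
    (b' : M.Dom) (hb : M.E a b') :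
    ∃ d' : N.Dom, N.E c d' ∧ IntLe tr M N (l + 1) a (Fin.snoc b b' : Fin (l + 1) → M.Dom) c
      (Fin.snoc d d' : Fin (l + 1) → N.Dom) := by
  let α := Fin (l + 1) ⊕ Fin 1
  let x : Var α 0 := Sum.inl (Sum.inl 0)
  let y : Var α 0 := Sum.inl (Sum.inr 0)
  let F (i : IntFormula I (l + 1)) : sig.Formula α :=
    st tr i x (Fin.snoc (fun t => Sum.inl (Sum.inl t.succ)) y : Fin (l + 1) → Var α 0)
  let γ (i : IntFormula I (l + 1)) : sig.Formula α :=
    atomic Rel.E ![x, y] ⊓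
      (if M.Forces tr i a (Fin.snoc b b' : Fin (l + 1) → M.Dom) then F i else ⊤)
  have key (w : Fin 1 → N.Dom) (i : IntFormula I (l + 1)) :
      (γ i).Realize (Sum.elim (Fin.cons c d) w) ↔
        N.E c (w 0) ∧ (M.Forces tr i a (Fin.snoc b b' : Fin (l + 1) → M.Dom) →
          N.Forces tr i c (Fin.snoc d (w 0) : Fin (l + 1) → N.Dom)) := by
    by_cases hi : M.Forces tr i a (Fin.snoc b b' : Fin (l + 1) → M.Dom) <;>
      simp [γ, F, hi, Formula.Realize, realize_st, rel_pair_iff, x, y, Model.E, elim_cons_snoc]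
  obtain ⟨w, hw⟩ := hN (l + 1) 1 _ (Fin.cons c d) γ (fun S => by
    obtain ⟨p, hp⟩ := exists_conj.{u} tr
      (S.filter fun i => M.Forces tr i a (Fin.snoc b b' : Fin (l + 1) → M.Dom))
    obtain ⟨d', hd, hf⟩ := h (.ex p)
      ⟨b', hb, (hp ..).2 fun j hj => (Finset.mem_filter.1 hj).2⟩
    exact ⟨fun _ => d', fun i hi => (key _ i).2 ⟨hd, fun hi' =>
      (hp ..).1 hf i (Finset.mem_filter.2 ⟨hi, hi'⟩)⟩⟩)
  simp only [key] at hw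
  exact ⟨w 0, (hw .bot).1, fun i => (hw i).2⟩

open Classical in
-- Only one direction is needed, so the type for the new world and object merely excludes the
-- formulas false at `c'` with `d'` appended. If no pair excluded finitely many of them, `∀w` of
-- their disjunction would hold at `a` and so at `c`, contradicting the choice of `c'` and `d'`.
lemma IntLe.worldObject_step {M N : Model.{u}} (hM : Model.IsSaturated.{u, v} M) {l : ℕ}
    {a : M.Dom} {b : Fin l → M.Dom} {c : N.Dom} {d : Fin l → N.Dom}
    (h : IntLe tr M N l a b c d) (c' d' : N.Dom) (hc : N.R c c') (hd : N.E c' d') :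
    ∃ a' b' : M.Dom, M.R a a' ∧ M.E a' b' ∧
      IntLe tr M N (l + 1) a' (Fin.snoc b b' : Fin (l + 1) → M.Dom) c'
        (Fin.snoc d d' : Fin (l + 1) → N.Dom) := by
  let α := Fin (l + 1) ⊕ Fin 2
  let x : Var α 0 := Sum.inl (Sum.inl 0)
  let y : Var α 0 := Sum.inl (Sum.inr 0)
  let z : Var α 0 := Sum.inl (Sum.inr 1)
  let F (i : IntFormula I (l + 1)) : sig.Formula α :=
    st tr i y (Fin.snoc (fun t => Sum.inl (Sum.inl t.succ)) z : Fin (l + 1) → Var α 0)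
  let γ (i : IntFormula I (l + 1)) : sig.Formula α :=
    atomic Rel.R ![x, y] ⊓ (atomic Rel.E ![y, z] ⊓
      (if N.Forces tr i c' (Fin.snoc d d' : Fin (l + 1) → N.Dom) then ⊤ else ∼(F i)))
  have key (w : Fin 2 → M.Dom) (i : IntFormula I (l + 1)) :
      (γ i).Realize (Sum.elim (Fin.cons a b) w) ↔
        M.R a (w 0) ∧ M.E (w 0) (w 1) ∧
          (M.Forces tr i (w 0) (Fin.snoc b (w 1) : Fin (l + 1) → M.Dom) →
            N.Forces tr i c' (Fin.snoc d d' : Fin (l + 1) → N.Dom)) := by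
    by_cases hi : N.Forces tr i c' (Fin.snoc d d' : Fin (l + 1) → N.Dom) <;>
      simp [γ, F, hi, Formula.Realize, realize_st, rel_pair_iff, x, y, z, Model.R, Model.E,
        elim_cons_snoc]
  obtain ⟨w, hw⟩ := hM (l + 1) 2 _ (Fin.cons a b) γ (fun S => by
    obtain ⟨q, hq⟩ := exists_disj.{u} tr
      (S.filter fun i => ¬ N.Forces tr i c' (Fin.snoc d d' : Fin (l + 1) → N.Dom))
    have hn : ¬ M.Forces tr (.all q) a b := fun hf => by
      obtain ⟨j, hj, hf⟩ := (hq ..).1 (h _ hf c' d' hc hd)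
      exact (Finset.mem_filter.1 hj).2 hf
    simp only [Model.Forces, not_forall] at hn
    obtain ⟨a', b', ha, hb, hf⟩ := hn
    refine ⟨![a', b'], fun i hi => (key _ i).2 ⟨ha, hb, fun h' => ?_⟩⟩
    by_contra hi'
    exact hf ((hq ..).2 ⟨i, Finset.mem_filter.2 ⟨hi, hi'⟩, h'⟩))
  simp only [key] at hw
  exact ⟨w 0, w 1, (hw .bot).1, (hw .bot).2.1, fun i => (hw i).2.2⟩

/-- Surjectivity of `tr` makes every letter other than `R` and `E` the translation of an
intuitionistic letter, which gives the clause for atoms. -/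
lemma IntLe.asimConditions (htr : ∀ k, Function.Surjective (tr k)) {M N : Model.{u}}
    (hM : Model.IsSaturated.{u, v} M) (hN : Model.IsSaturated.{u, v} N) :
    AsimConditions M N (IntLe tr M N) (IntLe tr N M) where
  atoms h k m _ w hr := by
    obtain ⟨p, rfl⟩ := htr k m
    exact h (.atom p w) hr
  world h c' hc := h.world_step tr hM c' hc
  object h b' hb := h.object_step tr hN b' hb
  worldObject h c' d' hc hd := h.worldObject_step tr hM c' d' hc hd

/-! ### The characterization of invariant formulas -/

lemma Model.ultra_sat {M : Model.{u}} {Θ : Vocabulary} (hM : M.voc = Θ) {n : ℕ} (a : M.Dom)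
    (b : Fin n → M.Dom) (φ : sig.Formula (Fin (n + 1))) :
    (ultra (fun _ => M) Θ fun _ => hM).Sat (ultraMk _ _ _ fun _ => a)
      (fun t => ultraMk _ _ _ fun _ => b t) φ ↔ M.Sat a b φ := by
  have h := ultra_realize (fun _ => M) Θ (fun _ => hM) φ
    (fun t _ => (Fin.cons a b : Fin (n + 1) → M.Dom) t)
  simp only [eventually_const] at h
  rw [Sat, Sat, ← h]
  have : (Fin.cons (ultraMk (fun _ => M) Θ (fun _ => hM) fun _ => a)
      (fun t => ultraMk (fun _ => M) Θ (fun _ => hM) fun _ => b t) :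
        Fin (n + 1) → (ultra (fun _ => M) Θ fun _ => hM).Dom) =
      fun t => ultraMk (fun _ => M) Θ (fun _ => hM) fun _ =>
        (Fin.cons a b : Fin (n + 1) → M.Dom) t := by
    funext t
    refine Fin.cases ?_ (fun t => ?_) t <;> rfl
  rw [this]

/-- An invariant formula is preserved when the truth of all intuitionistic formulas is. -/
lemma KInvariant.sat_of_intLe (htr : ∀ k, Function.Surjective (tr k)) {K : Set Model.{u}} {n : ℕ}
    {φ : sig.Formula (Fin (n + 1))} (hφ : KInvariant K φ) (hK : Axiomatizable K (vocOf φ))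
    {M N : Model.{u}} (hM : M ∈ restrict K (vocOf φ)) (hN : N ∈ restrict K (vocOf φ))
    {a : M.Dom} {b : Fin n → M.Dom} {c : N.Dom} {d : Fin n → N.Dom}
    (h : IntLe tr M N n a b c d) (ha : M.Sat a b φ) : N.Sat c d φ := by
  -- Replace both models by their ultrapowers, which stay in the class and are saturated. The
  -- diagonal embeddings are elementary, so φ can be moved up on the left and down on the right.
  have hM' := hK.ultra_mem fun _ => hM
  have hN' := hK.ultra_mem fun _ => hN
  have sM := Model.ultra_isSaturated.{u, v} (fun _ => M) _ fun _ => hM.2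
  have sN := Model.ultra_isSaturated.{u, v} (fun _ => N) _ fun _ => hN.2
  refine (Model.ultra_sat hN.2 c d φ).1 (hφ (vocOf φ) subset_rfl _ _ hM'.2 hN'.2 hM'.1 hN'.1 _ _ _ _
    ⟨IntLe tr _ _, IntLe tr _ _, fun i hi => ?_, IntLe.asimConditions tr htr sM sN,
      IntLe.asimConditions tr htr sN sM⟩ ((Model.ultra_sat hM.2 a b φ).2 ha))
  -- `IntLe` also passes to the ultrapowers, because forcing is first-order through the standard
  -- translation.
  rw [← sat_standardTranslation, Model.ultra_sat, sat_standardTranslation] at hi ⊢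
  exact h i hi

lemma exists_eq_cons {D : Type u} {n : ℕ} (f : Fin (n + 1) → D) :
    ∃ (a : D) (b : Fin n → D), f = Fin.cons a b :=
  ⟨f 0, fun t => f t.succ, (Fin.cons_self_tail f).symm⟩

/-- Let `C` be the set of intuitionistic consequences of φ over the class. Invariance shows that `C`
entails φ, and compactness reduces `C` to a finite conjunction. -/
lemma KInvariant.exists_intFormula (htr : ∀ k, Function.Surjective (tr k)) {K : Set Model.{u}}
    {n : ℕ} {φ : sig.Formula (Fin (n + 1))} (hφ : KInvariant K φ)
    (hK : Axiomatizable K (vocOf φ)) :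
    ∃ i : IntFormula I n, ∀ M ∈ restrict K (vocOf φ), ∀ (a : M.Dom) (b : Fin n → M.Dom),
      M.Sat a b φ ↔ M.Forces tr i a b := by
  classical
  let C := {i : IntFormula I n // ∀ M ∈ restrict K (vocOf φ), ∀ (a : M.Dom) (b : Fin n → M.Dom),
    M.Sat a b φ → M.Forces tr i a b}
  have top : C := ⟨.imp .bot .bot, fun _ _ _ _ _ _ _ h => h⟩
  have : Nonempty C := ⟨top⟩
  -- Given a point of `N` satisfying `C`, compactness finds a point satisfying φ at which every
  -- intuitionistic formula false at the given point fails. It lies below the given point in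
  -- `IntLe`, so φ transfers.
  have step : ∀ N ∈ restrict K (vocOf φ), ∀ (c : N.Dom) (d : Fin n → N.Dom),
      (∀ i : C, N.Forces tr i.1 c d) → N.Sat c d φ := by
    intro N hN c d hC
    let F := {i : IntFormula I n // ¬ N.Forces tr i c d}
    have bot : F := ⟨.bot, id⟩
    have : Nonempty F := ⟨bot⟩
    have key (M : Model.{u}) (a : M.Dom) (b : Fin n → M.Dom) (i : F) :
        (φ ⊓ ∼(standardTranslation tr i.1)).Realize (Fin.cons a b) ↔
          M.Sat a b φ ∧ ¬ M.Forces tr i.1 a b := by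
      rw [← sat_standardTranslation, Formula.realize_inf, Formula.realize_not]; rfl
    obtain ⟨M, hM, f, hf⟩ := hK.compactness
      (fun i : F => φ ⊓ ∼(standardTranslation tr i.1)) (fun S => by
        obtain ⟨q, hq⟩ := exists_disj.{u} tr (S.image Subtype.val)
        by_contra! hn
        -- If φ were incompatible with refuting all of `S`, the disjunction `q` would belong to `C`
        -- and hold at `(c, d)`, although every disjunct is false there.
        have hqC : ∀ M ∈ restrict K (vocOf φ), ∀ (a : M.Dom) (b : Fin n → M.Dom),
            M.Sat a b φ → M.Forces tr q a b := fun M hM a b ha => by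
          obtain ⟨i, hi, hf⟩ := hn M hM (Fin.cons a b)
          rw [key] at hf
          exact (hq ..).2 ⟨i, Finset.mem_image_of_mem _ hi, by tauto⟩
        obtain ⟨j, hj, hf⟩ := (hq ..).1 (hC ⟨q, hqC⟩)
        obtain ⟨i, -, rfl⟩ := Finset.mem_image.1 hj
        exact i.2 hf)
    obtain ⟨a, b, rfl⟩ := exists_eq_cons f
    simp only [key] at hf
    refine hφ.sat_of_intLe tr htr hK hM hN (fun i hi => ?_) (hf bot).1
    by_contra hi'
    exact (hf ⟨i, hi'⟩).2 hi
  have key (M : Model.{u}) (a : M.Dom) (b : Fin n → M.Dom) (i : C) :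
      (standardTranslation tr i.1 ⊓ ∼φ).Realize (Fin.cons a b) ↔
        M.Forces tr i.1 a b ∧ ¬ M.Sat a b φ := by
    rw [← sat_standardTranslation, Formula.realize_inf, Formula.realize_not]; rfl
  -- If no formula is equivalent to φ, no finite conjunction of members of `C` entails φ.
  -- Compactness then gives a point that satisfies `C` but not φ, contrary to `step`.
  by_contra! hn
  obtain ⟨M, hM, f, hf⟩ := hK.compactness
    (fun i : C => standardTranslation tr i.1 ⊓ ∼φ) (fun S => by
      obtain ⟨p, hp⟩ := exists_conj.{u} tr (S.image Subtype.val)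
      have hpC : ∀ M ∈ restrict K (vocOf φ), ∀ (a : M.Dom) (b : Fin n → M.Dom),
          M.Sat a b φ → M.Forces tr p a b := fun M hM a b ha => (hp ..).2 fun j hj => by
        obtain ⟨i, -, rfl⟩ := Finset.mem_image.1 hj
        exact i.2 M hM a b ha
      obtain ⟨M, hM, a, b, hab⟩ := hn p
      refine ⟨M, hM, Fin.cons a b, fun i hi => (key ..).2 ?_⟩
      have h₁ := hpC M hM a b
      have h₂ : M.Forces tr p a b → M.Forces tr i.1 a b :=
        fun h => (hp ..).1 h _ (Finset.mem_image_of_mem _ hi)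
      tauto)
  obtain ⟨a, b, rfl⟩ := exists_eq_cons f
  simp only [key] at hf
  exact (hf top).2 (step M hM a b fun i => (hf i).1)

end Saturated

/-! ### Equivalence over a class -/

lemma kFollows_singleton_iff {K : Set Model.{u}} {n : ℕ} {φ ψ : sig.Formula (Fin (n + 1))} :
    KFollows K {φ} ψ ↔ ∀ M ∈ K, IsFormulaOver M.voc φ → IsFormulaOver M.voc ψ →
      ∀ (a : M.Dom) (b : Fin n → M.Dom), M.Sat a b φ → M.Sat a b ψ := by
  have hl (Θ : Vocabulary) : IsFormulaOver Θ (∼ψ) ↔ IsFormulaOver Θ ψ := by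
    unfold IsFormulaOver
    erw [letters_not]
  constructor
  · intro h M hM h₁ h₂ a b hφ
    by_contra hψ
    refine h ⟨M, hM, ?_, Fin.cons a b, ?_⟩
    · rintro χ (rfl | rfl)
      exacts [h₁, (hl _).2 h₂]
    · rintro χ (rfl | rfl)
      exacts [hφ, hψ]
  · rintro h ⟨M, hM, hv, f, hf⟩
    obtain ⟨a, b, rfl⟩ := exists_eq_cons f
    exact hf (∼ψ) (Or.inr rfl) (h M hM (hv φ (Or.inl rfl)) ((hl _).1 (hv _ (Or.inr rfl))) a b
      (hf φ (Or.inl rfl)))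

theorem kInvariant_iff {I : ℕ → Type v} (tr : ∀ k, I k → ℕ)
    (htr : ∀ k, Function.Surjective (tr k)) {K : Set Model.{u}} (hr : ClosedUnderFiniteReducts K)
    (hK : FinitelyAxiomatizableParts K) (n : ℕ) (φ : sig.Formula (Fin (n + 1))) :
    KInvariant K φ ↔
      ∃ i : IntFormula I n, IsFormulaOver (vocOf φ) (standardTranslation tr i) ∧
        KEquivalent K φ (standardTranslation tr i) := by
  constructor
  · intro hφ
    obtain ⟨i, hi⟩ := hφ.exists_intFormula tr htr (hK _ (vocOf_finite φ))
    have hl := letters_st_relativize tr (vocOf φ) i (α := Fin (n + 1)) (m := 0)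
      (Sum.inl 0) (fun t => Sum.inl t.succ)
    have key (M : Model.{u}) (hM : M ∈ K) (hv : IsFormulaOver M.voc φ) (a : M.Dom)
        (b : Fin n → M.Dom) :
        M.Sat a b φ ↔ M.Sat a b (standardTranslation tr (i.relativize tr (vocOf φ))) := by
      -- The equivalence is known only for Σ_φ-models. Both φ and the relativized formula use
      -- letters of Σ_φ alone, so their truth can be tested in the reduct, which closure keeps in
      -- `K`.
      have hM' := hr M hM (vocOf φ) (vocOf_finite φ) (vocOf_subset hv)
      have h₁ := realize_reduct M (vocOf φ) φ Set.subset_union_right (Fin.cons a b) default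
      have h₂ := realize_reduct M (vocOf φ) _ hl (Fin.cons a b) default
      refine h₁.symm.trans (Iff.trans ?_ h₂)
      refine (hi _ ⟨hM', rfl⟩ a b).trans ?_
      exact ((sat_standardTranslation ..).trans (forces_relativize tr _ rfl i _ _)).symm
    refine ⟨i.relativize tr (vocOf φ), hl, kFollows_singleton_iff.2 ?_,
      kFollows_singleton_iff.2 ?_⟩
    · exact fun M hM hv _ a b h => (key M hM hv a b).1 h
    · exact fun M hM _ hv a b h => (key M hM hv a b).2 h
  · rintro ⟨i, hl, h₁, h₂⟩ Θ hΘ M N hM hN hMK hNK a b c d ⟨A, B, hA⟩ hφ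
    rw [kFollows_singleton_iff] at h₁ h₂
    subst hM
    have hφΘ : IsFormulaOver M.voc φ := Set.subset_union_right.trans hΘ
    have hiΘ : IsFormulaOver M.voc (standardTranslation tr i) := hl.trans hΘ
    refine h₂ N hNK (hN ▸ hiΘ) (hN ▸ hφΘ) c d ?_
    have := h₁ M hMK hφΘ hiΘ a b hφ
    rw [sat_standardTranslation] at this ⊢
    exact AsimConditions.forces tr i hN.symm hA.left hA.right hA.start this

/-! ### Axioms for intuitionistic models -/

namespace IntAxiom

/-- `x` is a world. -/
def world {m : ℕ} (x : Var Empty m) : sig.BoundedFormula Empty m :=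
  ∃' (atomic Rel.E ![x.lift, Var.new])

/-- `x` is an object. -/
def object {m : ℕ} (x : Var Empty m) : sig.BoundedFormula Empty m :=
  ∃' (atomic Rel.E ![Var.new, x.lift])

/-- The bound variable with index `t`. -/
abbrev var {m : ℕ} (t : Fin m) : Var Empty m := Sum.inr t

def worldIff : sig.Sentence :=
  ((world (var (0 : Fin 1)) ⟹ ∼(object (var 0))) ⊓
    (∼(object (var 0)) ⟹ world (var 0))).alls

def rWorld : sig.Sentence :=
  (atomic Rel.R ![var (0 : Fin 2), var 1] ⟹ (world (var 0) ⊓ world (var 1))).alls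

def rRefl : sig.Sentence := (world (var (0 : Fin 1)) ⟹ atomic Rel.R ![var 0, var 0]).alls

def rTrans : sig.Sentence :=
  (atomic Rel.R ![var (0 : Fin 3), var 1] ⟹
    (atomic Rel.R ![var 1, var 2] ⟹ atomic Rel.R ![var 0, var 2])).alls

def eMono : sig.Sentence :=
  (atomic Rel.E ![var (0 : Fin 3), var 2] ⟹
    (atomic Rel.R ![var 0, var 1] ⟹ atomic Rel.E ![var 1, var 2])).alls

/-- Variables `0` and `1` are the two worlds; the remaining `k` variables, starting at index `2`,
are the arguments. -/
def pMono (k m : ℕ) : sig.Sentence :=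
  (atomic (Rel.P k m) (Fin.cons (var (0 : Fin (k + 2))) (fun t => var t.succ.succ)) ⟹
    (atomic Rel.R ![var 0, var 1] ⟹
      atomic (Rel.P k m) (Fin.cons (var 1) (fun t => var t.succ.succ)))).alls

/-- There is one sentence for each argument place `t`; variable `0` is the world. -/
def pType (k m : ℕ) (t : Fin k) : sig.Sentence :=
  (atomic (Rel.P k m) (fun s => var (s : Fin (k + 1))) ⟹
    atomic Rel.E ![var 0, var t.succ]).alls

def constDomain : sig.Sentence :=
  (object (var (1 : Fin 2)) ⟹ (world (var 0) ⟹ atomic Rel.E ![var 0, var 1])).alls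

/-- The axioms for intuitionistic `Θ`-models. -/
def axioms (Θ : Vocabulary) : Set sig.Sentence :=
  {worldIff, rWorld, rRefl, rTrans, eMono} ∪
    ({ψ | ∃ k m, (⟨k + 1, Rel.P k m⟩ : Letter) ∈ Θ.letters ∧ ψ = pMono k m} ∪
      {ψ | ∃ k m, (⟨k + 1, Rel.P k m⟩ : Letter) ∈ Θ.letters ∧ ∃ t, ψ = pType k m t})

variable {M : Model.{u}}

@[simp] lemma realize_world {m : ℕ} (x : Var Empty m) (f : Empty → M.Dom) (xs : Fin m → M.Dom) :
    (world x).Realize f xs ↔ M.IsWorld (Sum.elim f xs x) := by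
  simp [world, rel_pair_iff, Model.IsWorld, Model.E]

@[simp] lemma realize_object {m : ℕ} (x : Var Empty m) (f : Empty → M.Dom) (xs : Fin m → M.Dom) :
    (object x).Realize f xs ↔ M.IsObject (Sum.elim f xs x) := by
  simp [object, rel_pair_iff, Model.IsObject, Model.E]

@[simp] lemma realize_R {m : ℕ} (x y : Var Empty m) (f : Empty → M.Dom) (xs : Fin m → M.Dom) :
    (atomic Rel.R ![x, y]).Realize f xs ↔ M.R (Sum.elim f xs x) (Sum.elim f xs y) := by
  simp [rel_pair_iff, Model.R]

@[simp] lemma realize_E {m : ℕ} (x y : Var Empty m) (f : Empty → M.Dom) (xs : Fin m → M.Dom) :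
    (atomic Rel.E ![x, y]).Realize f xs ↔ M.E (Sum.elim f xs x) (Sum.elim f xs y) := by
  simp [rel_pair_iff, Model.E]

lemma models_alls {m : ℕ} (φ : sig.BoundedFormula Empty m) :
    M.Dom ⊨ φ.alls ↔ ∀ xs : Fin m → M.Dom, φ.Realize default xs :=
  BoundedFormula.realize_alls

@[simp] lemma models_worldIff : M.Dom ⊨ worldIff ↔ ∀ x, M.IsWorld x ↔ ¬ M.IsObject x := by
  rw [worldIff, models_alls]
  simp only [BoundedFormula.realize_inf, BoundedFormula.realize_imp, BoundedFormula.realize_not,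
    realize_world, realize_object, Sum.elim_inr, ← iff_def]
  exact ⟨fun h x => h ![x], fun h xs => h _⟩

@[simp] lemma models_rWorld :
    M.Dom ⊨ rWorld ↔ ∀ x y, M.R x y → M.IsWorld x ∧ M.IsWorld y := by
  rw [rWorld, models_alls]
  simp only [BoundedFormula.realize_inf, BoundedFormula.realize_imp, realize_world, realize_R,
    Sum.elim_inr]
  exact ⟨fun h x y => h ![x, y], fun h xs => h _ _⟩

@[simp] lemma models_rRefl : M.Dom ⊨ rRefl ↔ ∀ y, M.IsWorld y → M.R y y := by
  rw [rRefl, models_alls]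
  simp only [BoundedFormula.realize_imp, realize_world, realize_R, Sum.elim_inr]
  exact ⟨fun h x => h ![x], fun h xs => h _⟩

@[simp] lemma models_rTrans : M.Dom ⊨ rTrans ↔ ∀ x y z, M.R x y → M.R y z → M.R x z := by
  rw [rTrans, models_alls]
  simp only [BoundedFormula.realize_imp, realize_R, Sum.elim_inr]
  exact ⟨fun h x y z => h ![x, y, z], fun h xs => h _ _ _⟩

@[simp] lemma models_eMono : M.Dom ⊨ eMono ↔ ∀ y z w, M.E y w → M.R y z → M.E z w := by
  rw [eMono, models_alls]
  simp only [BoundedFormula.realize_imp, realize_R, realize_E, Sum.elim_inr]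
  exact ⟨fun h x y z => h ![x, y, z], fun h xs => h _ _ _⟩

@[simp] lemma models_pMono (k m : ℕ) :
    M.Dom ⊨ pMono k m ↔ ∀ (y z : M.Dom) (w : Fin k → M.Dom),
      M.rel (Rel.P k m) (Fin.cons y w : Fin (k + 1) → M.Dom) → M.R y z →
        M.rel (Rel.P k m) (Fin.cons z w : Fin (k + 1) → M.Dom) := by
  have key (f : Empty → M.Dom) (xs : Fin (k + 2) → M.Dom) (s : Fin (k + 2)) :
      (fun t => Sum.elim f xs ((Fin.cons (var s) (fun t => var t.succ.succ) :
        Fin (k + 1) → Var Empty (k + 2)) t)) =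
        (Fin.cons (xs s) (fun t => xs t.succ.succ) : Fin (k + 1) → M.Dom) := by
    funext t
    refine Fin.cases ?_ (fun t => ?_) t <;> rfl
  rw [pMono, models_alls]
  simp only [BoundedFormula.realize_imp, realize_R, Sum.elim_inr]
  simp only [realize_atomic, key]
  exact ⟨fun h y z w => h (Fin.cons y (Fin.cons z w : Fin (k + 1) → M.Dom)), fun h xs => h _ _ _⟩

@[simp] lemma models_pType (k m : ℕ) (t : Fin k) :
    M.Dom ⊨ pType k m t ↔ ∀ (y : M.Dom) (w : Fin k → M.Dom),
      M.rel (Rel.P k m) (Fin.cons y w : Fin (k + 1) → M.Dom) → M.E y (w t) := by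
  rw [pType, models_alls]
  simp only [BoundedFormula.realize_imp, realize_E, Sum.elim_inr]
  simp only [realize_atomic, Sum.elim_inr]
  refine ⟨fun h y w => h (Fin.cons y w), fun h xs hx => h (xs 0) (fun t => xs t.succ) ?_⟩
  exact (Fin.cons_self_tail xs).symm ▸ hx

@[simp] lemma models_constDomain :
    M.Dom ⊨ constDomain ↔ ∀ z, M.IsObject z → ∀ y, M.IsWorld y → M.E y z := by
  rw [constDomain, models_alls]
  simp only [BoundedFormula.realize_imp, realize_E, realize_world, realize_object, Sum.elim_inr]
  exact ⟨fun h z hz y hy => h ![y, z] hz hy, fun h xs hz hy => h _ hz _ hy⟩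

@[simp] lemma letters_world {m : ℕ} (x : Var Empty m) :
    letters (world x) = {(⟨2, Rel.E⟩ : Letter)} := by simp [world]

@[simp] lemma letters_object {m : ℕ} (x : Var Empty m) :
    letters (object x) = {(⟨2, Rel.E⟩ : Letter)} := by simp [object]

lemma isFormulaOver_axioms (Θ : Vocabulary) : ∀ ψ ∈ axioms Θ, IsFormulaOver Θ ψ := by
  have hR := Θ.R_mem
  have hE := Θ.E_mem
  rintro ψ ((rfl | rfl | rfl | rfl | rfl) | ⟨k, m, h, rfl⟩ | ⟨k, m, h, t, rfl⟩) <;>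
    simp [IsFormulaOver, worldIff, rWorld, rRefl, rTrans, eMono, pMono, pType, letters_alls,
      Set.insert_subset_iff, *]

lemma isFormulaOver_constDomain (Θ : Vocabulary) : IsFormulaOver Θ constDomain := by
  simp [IsFormulaOver, constDomain, letters_alls, Θ.E_mem]

lemma isIntuitionistic_iff {Θ : Vocabulary} (hM : M.voc = Θ) :
    M.IsIntuitionistic ↔ ∀ ψ ∈ axioms Θ, M.Dom ⊨ ψ := by
  constructor
  · rintro h ψ ((rfl | rfl | rfl | rfl | rfl) | ⟨k, m, -, rfl⟩ | ⟨k, m, -, t, rfl⟩)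
    · exact models_worldIff.2 h.world_iff
    · exact models_rWorld.2 h.R_world
    · exact models_rRefl.2 h.R_refl
    · exact models_rTrans.2 h.R_trans
    · exact models_eMono.2 h.E_mono
    · exact (models_pMono k m).2 (h.P_mono k m)
    · exact (models_pType k m t).2 fun y w hw => h.P_type k m y w hw t
  · intro h
    -- The axioms mention only letters of Θ. For other letters the conditions are vacuous, since a
    -- true atom forces its letter into the vocabulary.
    have mem {k m : ℕ} {w : Fin (k + 1) → M.Dom} (hw : M.rel (Rel.P k m) w) :
        (⟨k + 1, Rel.P k m⟩ : Letter) ∈ Θ.letters := hM ▸ M.rel_voc _ _ hw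
    exact
      { world_iff := models_worldIff.1 (h _ (by simp [axioms]))
        R_world := models_rWorld.1 (h _ (by simp [axioms]))
        R_refl := models_rRefl.1 (h _ (by simp [axioms]))
        R_trans := models_rTrans.1 (h _ (by simp [axioms]))
        E_mono := models_eMono.1 (h _ (by simp [axioms]))
        P_mono := fun k m y z w hw =>
          (models_pMono k m).1 (h _ (Or.inr (Or.inl ⟨k, m, mem hw, rfl⟩))) y z w hw
        P_type := fun k m y w hw t =>
          (models_pType k m t).1 (h _ (Or.inr (Or.inr ⟨k, m, mem hw, t, rfl⟩))) y w hw }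

end IntAxiom

/-! ### Reducts of intuitionistic models -/

section Reducts
variable (M : Model.{u}) (Θ : Vocabulary)

/-- `R` and `E` belong to every vocabulary, so reducts leave accessibility, worlds and objects
unchanged. -/
lemma reduct_R (x y : (M.reduct Θ).Dom) : (M.reduct Θ).R x y ↔ M.R x y := and_iff_right Θ.R_mem

lemma reduct_E (x y : (M.reduct Θ).Dom) : (M.reduct Θ).E x y ↔ M.E x y := and_iff_right Θ.E_mem

lemma reduct_isWorld (x : (M.reduct Θ).Dom) : (M.reduct Θ).IsWorld x ↔ M.IsWorld x :=
  exists_congr fun z => reduct_E M Θ x z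

lemma reduct_isObject (x : (M.reduct Θ).Dom) : (M.reduct Θ).IsObject x ↔ M.IsObject x :=
  exists_congr fun z => reduct_E M Θ z x

variable {M} in
lemma Model.IsIntuitionistic.reduct (h : M.IsIntuitionistic) :
    (M.reduct Θ).IsIntuitionistic where
  world_iff x := by
    rw [reduct_isWorld M Θ, reduct_isObject M Θ]
    exact h.world_iff x
  R_world x y := by
    rw [reduct_isWorld M Θ, reduct_isWorld M Θ, reduct_R M Θ]
    exact h.R_world x y
  R_refl y := by
    rw [reduct_isWorld M Θ, reduct_R M Θ]
    exact h.R_refl y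
  R_trans x y z := by
    rw [reduct_R M Θ, reduct_R M Θ, reduct_R M Θ]
    exact h.R_trans x y z
  E_mono y z w := by
    rw [reduct_R M Θ, reduct_E M Θ, reduct_E M Θ]
    exact h.E_mono y z w
  P_mono k m y z w hw hR := ⟨hw.1, h.P_mono k m y z w hw.2 ((reduct_R M Θ y z).1 hR)⟩
  P_type k m y w hw t := (reduct_E M Θ y (w t)).2 (h.P_type k m y w hw.2 t)

end Reducts

/-! ### The hypotheses on `K` for the two classes of intuitionistic models -/

lemma intModels_closedUnderFiniteReducts : ClosedUnderFiniteReducts intModels.{u} :=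
  fun _ hM _ _ _ => Model.IsIntuitionistic.reduct _ hM

lemma constDomainModels_closedUnderFiniteReducts :
    ClosedUnderFiniteReducts constDomainModels.{u} := by
  refine fun M hM Θ _ _ => ⟨hM.1.reduct Θ, fun z hz y hy => ?_⟩
  rw [reduct_isObject M Θ] at hz
  rw [reduct_isWorld M Θ] at hy
  exact (reduct_E M Θ y z).2 (hM.2 z hz y hy)

lemma intModels_finitelyAxiomatizableParts : FinitelyAxiomatizableParts intModels.{u} :=
  fun Θ _ => ⟨IntAxiom.axioms Θ, IntAxiom.isFormulaOver_axioms Θ, fun _ hM =>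
    (and_iff_left hM).trans (IntAxiom.isIntuitionistic_iff hM)⟩

lemma constDomainModels_finitelyAxiomatizableParts :
    FinitelyAxiomatizableParts constDomainModels.{u} := by
  refine fun Θ _ => ⟨insert IntAxiom.constDomain (IntAxiom.axioms Θ), ?_, fun M hM => ?_⟩
  · rintro ψ (rfl | hψ)
    exacts [IntAxiom.isFormulaOver_constDomain Θ, IntAxiom.isFormulaOver_axioms Θ ψ hψ]
  · rw [Set.forall_mem_insert, IntAxiom.models_constDomain, ← IntAxiom.isIntuitionistic_iff hM,
      and_comm]
    exact and_iff_left hM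

end PredAsim

open PredAsim
theorem mainTheorem3 {I : ℕ → Type v} (tr : ∀ k, I k → ℕ)
    (htr : ∀ k, Function.Surjective (tr k)) :
    (∀ K : Set Model.{u}, ClosedUnderFiniteReducts K → FinitelyAxiomatizableParts K →
      ∀ (n : ℕ) (φ : sig.Formula (Fin (n + 1))),
        KInvariant K φ ↔
          ∃ i : IntFormula I n, IsFormulaOver (vocOf φ) (standardTranslation tr i) ∧
            KEquivalent K φ (standardTranslation tr i)) ∧
    (ClosedUnderFiniteReducts intModels.{u} ∧ FinitelyAxiomatizableParts intModels.{u}) ∧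
    (ClosedUnderFiniteReducts constDomainModels.{u} ∧
      FinitelyAxiomatizableParts constDomainModels.{u}) :=
  ⟨fun _ hr hK n φ => kInvariant_iff tr htr hr hK n φ,
    ⟨intModels_closedUnderFiniteReducts, intModels_finitelyAxiomatizableParts⟩,
    ⟨constDomainModels_closedUnderFiniteReducts, constDomainModels_finitelyAxiomatizableParts⟩⟩
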